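/- Let $\alpha>\alpha_0:=\frac{-5+\sqrt{17}}{2}$ and $1\le p\le\infty$. For $n\in\mathbb N=\{0,1,2,\dots\}$ put $w(n)=\binom{n+\alpha}{n}$, let $L_n^\alpha(x)=\sum_{i=0}^n(-1)^i\binom{n+\alpha}{n-i}\frac{x^i}{i!}$ be the Laguerre polynomial, and let $R_n^\alpha=L_n^\alpha/w(n)$, so that $R_n^\alpha(0)=1$. For $n,m,k\in\mathbb N$ let $$\gamma(n,m,k)=\frac1{\Gamma(\alpha+1)}\int_0^\infty R_n^\alpha(x)R_m^\alpha(x)R_k^\alpha(x)e^{-2x}x^\alpha\,dx .$$ Let $\ell^p_\alpha$ be the space of real sequences $a=(a(k))_{k\ge0}$ with $\|a\|_{p,\alpha}<\infty$, where $\|a\|_{p,\alpha}=\bigl(\sum_{k=0}^\infty|a(k)|^pw(k)\bigr)^{1/p}$ for $p<\infty$ and $\|a\|_{\infty,\alpha}=\sup_k|a(k)|$. Then for every $k\in\mathbb N$ and every $a\in\ell^p_\alpha$ the series $$T_k(a)(n)=\sum_{m=0}^\infty a(m)w(m)\gamma(n,m,k)$$ converges absolutely for every $n\in\mathbb N$,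 the sequence $T_k(a)$ belongs to $\ell^p_\alpha$, and $$\|T_k(a)\|_{p,\alpha}\le\|a\|_{p,\alpha}.$$ -/

import Mathlib

open scoped ENNReal

noncomputable section

namespace LaguerreSeq

/-- The weight `w(k) = binom(k + α, k)`. -/
def weight (α : ℝ) (k : ℕ) : ℝ := Ring.choose ((k : ℝ) + α) k

/-- The Laguerre polynomial
`L_n^α(x) = ∑_{i=0}^n (-1)^i binom(n + α, n - i) x^i / i!`, as a function of `x`. -/
def laguerre (α : ℝ) (n : ℕ) (x : ℝ) : ℝ :=
  ∑ i ∈ Finset.range (n + 1),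
    (-1) ^ i * Ring.choose ((n : ℝ) + α) (n - i) * x ^ i / (Nat.factorial i : ℝ)

/-- The Laguerre polynomial normalized to have value `1` at `0`:
`R_n^α(x) = L_n^α(x) / binom(n + α, n)`. -/
def laguerreR (α : ℝ) (n : ℕ) (x : ℝ) : ℝ := laguerre α n x / weight α n

/-- The linearization coefficients
`γ(n,m,k) = Γ(α+1)⁻¹ ∫_0^∞ R_n^α(x) R_m^α(x) R_k^α(x) e^{-2x} x^α dx`.
The factor `Γ(α+1)⁻¹` is the one for which `∑_k γ(n,m,k) w(k) = 1`. -/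
def gam (α : ℝ) (n m k : ℕ) : ℝ :=
  (Real.Gamma (α + 1))⁻¹ *
    ∫ x in Set.Ioi (0 : ℝ),
      laguerreR α n x * laguerreR α m x * laguerreR α k x * Real.exp (-2 * x) * x ^ α

/-- The Laguerre translation on sequences,
`T_k(a)(n) = ∑_{m=0}^∞ a(m) w(m) γ(n,m,k)`. -/
def translation (α : ℝ) (k : ℕ) (a : ℕ → ℝ) (n : ℕ) : ℝ :=
  ∑' m : ℕ, a m * weight α m * gam α n m k

/-- Membership of a real sequence in the weighted space `ℓ^p_α`: for `p < ∞`,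
`∑_k |a(k)|^p w(k) < ∞`; for `p = ∞`, boundedness. -/
def MemSpace (α : ℝ) (p : ℝ≥0∞) (a : ℕ → ℝ) : Prop :=
  if p = ∞ then BddAbove (Set.range fun k => |a k|)
  else Summable fun k => |a k| ^ p.toReal * weight α k

/-- The norm of `ℓ^p_α`: `(∑_k |a(k)|^p w(k))^{1/p}` for `p < ∞` and `sup_k |a(k)|` for `p = ∞`
(meaningful for sequences satisfying `MemSpace α p`). -/
def seqNorm (α : ℝ) (p : ℝ≥0∞) (a : ℕ → ℝ) : ℝ :=
  if p = ∞ then ⨆ k, |a k|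
  else (∑' k, |a k| ^ p.toReal * weight α k) ^ (1 / p.toReal)

end LaguerreSeq

end

open Polynomial Filter Topology Asymptotics

noncomputable section

namespace LaguerreSeq

/-! For fixed `k`, `K n m = w m * γ(n,m,k)` is a Markov kernel, reversible with respect to `w`; such
kernels contract every weighted `ℓ^p`, by Jensen and detailed balance. Reversibility is the symmetry
of `γ`; two facts remain.

Nonnegativity (`tripleIntegral_nonneg`): since `e^{-2x} = e^{-x} e^{-x}`, one factor can serve as
the Sturm–Liouville weight of a Wronskian and the other be absorbed by integration by parts. This
yields the two-term recurrence `tripleIntegral_succ_succ`. Lowering the largest index keeps its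
coefficients nonnegative, except at indices `(1,1,1)`, where the sign is that of `α² + 5α + 2`,
whose larger root is `α₀`.

Row sums equal to one (`hasSum_weight_mul_gam`): by Christoffel–Darboux at the origin, `∑ L_m` acts
on polynomials as evaluation at `0`, and `R_n(0) R_k(0) = 1`. -/

theorem succ_mul_choose_succ (r : ℝ) (k : ℕ) :
    ((k : ℝ) + 1) * Ring.choose r (k + 1) = r * Ring.choose (r - 1) k := by
  have h := Ring.choose_smul_choose r (n := k + 1) (k := 1) (by omega)
  simpa using h

/-! ### Weights and classical Laguerre identities -/

theorem weight_zero (α : ℝ) : weight α 0 = 1 := by simp [weight]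

theorem weight_succ (α : ℝ) (n : ℕ) :
    ((n : ℝ) + 1) * weight α (n + 1) = (n + (α + 1)) * weight α n := by
  unfold weight
  rw [succ_mul_choose_succ]
  rw [show ((n + 1 : ℕ) : ℝ) + α - 1 = n + α by push_cast; ring]
  push_cast
  ring

theorem weight_pos {α : ℝ} (hα : 0 < α + 1) (n : ℕ) : 0 < weight α n := by
  induction n with
  | zero => simp [weight_zero]
  | succ n ih =>
    have h := weight_succ α n
    have : 0 < ((n : ℝ) + (α + 1)) * weight α n := by positivity
    rw [← h] at this
    exact pos_of_mul_pos_right this (by positivity)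

/-- The Laguerre polynomial as an element of `ℝ[X]`. -/
def laguerrePoly (α : ℝ) (n : ℕ) : ℝ[X] :=
  ∑ i ∈ Finset.range (n + 1),
    C ((-1) ^ i * Ring.choose ((n : ℝ) + α) (n - i) / (Nat.factorial i : ℝ)) * X ^ i

theorem eval_laguerrePoly (α : ℝ) (n : ℕ) (x : ℝ) :
    (laguerrePoly α n).eval x = laguerre α n x := by
  simp only [laguerrePoly, laguerre, eval_finsetSum, eval_mul, eval_C, eval_pow, eval_X]
  exact Finset.sum_congr rfl fun i _ => by ring

theorem coeff_laguerrePoly (α : ℝ) (n i : ℕ) :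
    (laguerrePoly α n).coeff i =
      if i ≤ n then (-1) ^ i * Ring.choose ((n : ℝ) + α) (n - i) / (Nat.factorial i : ℝ)
      else 0 := by
  simp only [laguerrePoly, finsetSum_coeff, coeff_C_mul_X_pow]
  simp

theorem laguerrePoly_zero (α : ℝ) : laguerrePoly α 0 = 1 := by
  simp [laguerrePoly]

theorem laguerre_zero_right (α : ℝ) (n : ℕ) : laguerre α n 0 = weight α n := by
  rw [laguerre, Finset.sum_eq_single 0] <;> simp +contextual [weight]

theorem X_mul_derivative_laguerrePoly (α : ℝ) (n : ℕ) :
    X * derivative (laguerrePoly α (n + 1)) =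
      ((n : ℝ[X]) + 1) * laguerrePoly α (n + 1) - C ((n : ℝ) + 1 + α) * laguerrePoly α n := by
  have e : ((n : ℝ[X]) + 1) = C ((n : ℝ) + 1) := by simp
  rw [e]
  ext i
  simp only [coeff_sub, coeff_C_mul]
  have h1 : (X * derivative (laguerrePoly α (n + 1))).coeff i =
      i * (laguerrePoly α (n + 1)).coeff i := by
    cases i with
    | zero => simp
    | succ i => rw [coeff_X_mul, coeff_derivative]; push_cast; ring
  rw [h1]
  simp only [coeff_laguerrePoly]
  rcases lt_trichotomy i (n + 1) with h | h | h
  · obtain ⟨d, rfl⟩ : ∃ d, n = i + d := ⟨n - i, by omega⟩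
    rw [if_pos (by omega), if_pos (by omega), show i + d + 1 - i = d + 1 by omega,
      show i + d - i = d by omega]
    have := succ_mul_choose_succ (((i + d + 1 : ℕ) : ℝ) + α) d
    rw [show ((i + d + 1 : ℕ) : ℝ) + α - 1 = ((i + d : ℕ) : ℝ) + α by push_cast; ring] at this
    push_cast at this ⊢
    linear_combination (-(-1) ^ i / (Nat.factorial i : ℝ)) * this
  · subst h
    simp
  · rw [if_neg (by omega), if_neg (by omega)]
    simp

theorem derivative_laguerrePoly_succ (α : ℝ) (n : ℕ) :
    derivative (laguerrePoly α (n + 1)) =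
      derivative (laguerrePoly α n) - laguerrePoly α n := by
  ext i
  simp only [coeff_sub, coeff_derivative, coeff_laguerrePoly]
  have hf : (Nat.factorial (i + 1) : ℝ) = (i + 1) * Nat.factorial i := by
    push_cast [Nat.factorial_succ]; ring
  have hi : (Nat.factorial i : ℝ) ≠ 0 := by positivity
  have hi' : (i : ℝ) + 1 ≠ 0 := by positivity
  rcases lt_trichotomy i n with h | h | h
  · obtain ⟨d, rfl⟩ : ∃ d, n = i + 1 + d := ⟨n - i - 1, by omega⟩
    rw [if_pos (by omega), if_pos (by omega), if_pos (by omega),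
      show i + 1 + d + 1 - (i + 1) = d + 1 by omega,
      show i + 1 + d - (i + 1) = d by omega, show i + 1 + d - i = d + 1 by omega]
    have := Ring.choose_succ_succ (((i + 1 + d : ℕ) : ℝ) + α) d
    rw [show ((i + 1 + d + 1 : ℕ) : ℝ) + α = ((i + 1 + d : ℕ) : ℝ) + α + 1 by push_cast; ring,
      this, hf]
    field_simp
    ring
  · subst h
    simp only [le_refl, if_true, Nat.sub_self, Ring.choose_zero_right, hf]
    rw [if_neg (by omega)]
    field_simp
    ring
  · rw [if_neg (by omega), if_neg (by omega), if_neg (by omega)]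
    simp

/-- The three-term relation in its first-order differential form. -/
theorem succ_mul_laguerrePoly_succ (α : ℝ) (n : ℕ) :
    ((n : ℝ[X]) + 1) * laguerrePoly α (n + 1) =
      ((n : ℝ[X]) + C (α + 1) - X) * laguerrePoly α n + X * derivative (laguerrePoly α n) := by
  have h1 := X_mul_derivative_laguerrePoly α n
  rw [derivative_laguerrePoly_succ] at h1
  simp only [C_add, map_natCast, C_1] at *
  linear_combination -h1

/-- Laguerre's differential equation. -/
theorem laguerrePoly_ode (α : ℝ) (n : ℕ) :
    X * derivative (derivative (laguerrePoly α n)) =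
      -(C (α + 1) - X) * derivative (laguerrePoly α n) - (n : ℝ[X]) * laguerrePoly α n := by
  have h := congrArg derivative (succ_mul_laguerrePoly_succ α n)
  simp only [derivative_mul, derivative_add, derivative_sub, derivative_natCast, derivative_one,
    derivative_X, derivative_C, derivative_laguerrePoly_succ] at h
  linear_combination -h

/-! ### Integration against `e^{-2x} x^α` -/

theorem integrableOn_eval_mul (α : ℝ) (hα : 0 < α + 1) (q : ℝ[X]) :
    MeasureTheory.IntegrableOn (fun x : ℝ => q.eval x * Real.exp (-2 * x) * x ^ α)
      (Set.Ioi 0) := by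
  induction q using Polynomial.induction_on' with
  | add p q hp hq =>
    refine (hp.add hq).congr_fun (fun x _ => ?_) measurableSet_Ioi
    simp only [Pi.add_apply, eval_add]
    ring
  | monomial j c =>
    have h := integrableOn_rpow_mul_exp_neg_mul_rpow (p := 1) (s := j + α) (b := 2)
      (by have : (0 : ℝ) ≤ j := by positivity
          linarith) one_pos two_pos
    refine MeasureTheory.IntegrableOn.congr_fun (h.const_mul c) (fun x hx => ?_) measurableSet_Ioi
    have hx : 0 < x := hx
    simp only [eval_monomial, Real.rpow_add hx, Real.rpow_natCast, Real.rpow_one]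
    ring

/-- The functional `q ↦ Γ(α+1)⁻¹ ∫₀^∞ q(x) e^{-2x} x^α dx` on polynomials. -/
def laguerreFunctional (α : ℝ) (hα : 0 < α + 1) : ℝ[X] →ₗ[ℝ] ℝ where
  toFun q := (Real.Gamma (α + 1))⁻¹ *
    ∫ x in Set.Ioi (0 : ℝ), q.eval x * Real.exp (-2 * x) * x ^ α
  map_add' p q := by
    rw [← mul_add, ← MeasureTheory.integral_add (integrableOn_eval_mul α hα p)
      (integrableOn_eval_mul α hα q)]
    simp only [eval_add, add_mul]
  map_smul' c q := by
    simp only [eval_smul, smul_eq_mul, RingHom.id_apply, mul_assoc,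
      MeasureTheory.integral_const_mul]
    ring

theorem laguerreFunctional_X_pow (α : ℝ) (hα : 0 < α + 1) (j : ℕ) :
    laguerreFunctional α hα (X ^ j) =
      (Real.Gamma (α + 1))⁻¹ * ((1 / 2) ^ (j + (α + 1)) * Real.Gamma (j + (α + 1))) := by
  have hj : (0 : ℝ) < j + (α + 1) := by positivity
  rw [← Real.integral_rpow_mul_exp_neg_mul_Ioi hj two_pos]
  refine congrArg (fun t => (Real.Gamma (α + 1))⁻¹ * t) ?_
  refine MeasureTheory.setIntegral_congr_fun measurableSet_Ioi fun x hx => ?_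
  have hx : 0 < x := hx
  simp only [eval_pow, eval_X]
  rw [show (j : ℝ) + (α + 1) - 1 = j + α by ring, Real.rpow_add hx, Real.rpow_natCast, neg_mul]
  ring

theorem laguerreFunctional_one (α : ℝ) (hα : 0 < α + 1) :
    laguerreFunctional α hα 1 = (1 / 2) ^ (α + 1) := by
  have h := laguerreFunctional_X_pow α hα 0
  have := (Real.Gamma_pos_of_pos hα).ne'
  simp only [pow_zero, Nat.cast_zero, zero_add] at h
  rw [h]
  field_simp

/-- Integration by parts. -/
theorem laguerreFunctional_parts (α : ℝ) (hα : 0 < α + 1) (p : ℝ[X]) :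
    laguerreFunctional α hα (X * derivative p + (C (α + 1) - 2 * X) * p) = 0 := by
  induction p using Polynomial.induction_on' with
  | add p q hp hq =>
    rw [← add_zero (0 : ℝ)]
    nth_rw 1 [← hp]
    rw [← hq, ← map_add]
    congr 1
    simp only [derivative_add]
    ring
  | monomial j c =>
    have e : X * derivative (monomial j c) + (C (α + 1) - 2 * X) * monomial j c =
        (c * (j + (α + 1))) • X ^ j - (2 * c) • X ^ (j + 1) := by
      rw [← C_mul_X_pow_eq_monomial]
      simp only [smul_eq_C_mul, derivative_C_mul, derivative_X_pow, C_mul, C_add, map_natCast,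
        C_ofNat]
      cases j with
      | zero => simp; ring
      | succ j => simp only [Nat.add_sub_cancel]; ring
    rw [e, map_sub, map_smul, map_smul, laguerreFunctional_X_pow, laguerreFunctional_X_pow]
    have hj : (0 : ℝ) < j + (α + 1) := by positivity
    rw [show ((j + 1 : ℕ) : ℝ) + (α + 1) = (j + (α + 1)) + 1 by push_cast; ring,
      Real.Gamma_add_one hj.ne', Real.rpow_add_one (by norm_num)]
    simp only [smul_eq_mul]
    ring

/-- `Γ(α+1)⁻¹ ∫₀^∞ L_l L_m L_n e^{-2x} x^α dx`. -/
def tripleIntegral (α : ℝ) (hα : 0 < α + 1) (l m n : ℕ) : ℝ :=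
  laguerreFunctional α hα (laguerrePoly α l * laguerrePoly α m * laguerrePoly α n)

/-! ### Recurrence for the triple integrals -/

section Recurrence

variable (α : ℝ) (hα : 0 < α + 1)

theorem tripleIntegral_swap_left (l m n : ℕ) :
    tripleIntegral α hα l m n = tripleIntegral α hα m l n := by
  unfold tripleIntegral; congr 1; ring

theorem tripleIntegral_swap_right (l m n : ℕ) :
    tripleIntegral α hα l m n = tripleIntegral α hα l n m := by
  unfold tripleIntegral; congr 1; ring

/-- The Wronskian of `L_n` and `L_m` is integrated by parts against `e^{-x} L`, where
`L = U - U'`. -/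
theorem laguerreFunctional_wronskian (U : ℝ[X]) (m n : ℕ) :
    laguerreFunctional α hα (X * (U - derivative U) *
      (derivative (laguerrePoly α n) * laguerrePoly α m -
        laguerrePoly α n * derivative (laguerrePoly α m))) =
    ((m : ℝ) - n) * laguerreFunctional α hα (U * laguerrePoly α m * laguerrePoly α n) := by
  have h := laguerreFunctional_parts α hα (U *
    (derivative (laguerrePoly α n) * laguerrePoly α m -
        laguerrePoly α n * derivative (laguerrePoly α m)))
  have hm := laguerrePoly_ode α m
  have hn := laguerrePoly_ode α n
  rw [← smul_eq_mul (a := (m : ℝ) - n), ← map_smul, ← sub_eq_zero, ← map_sub, ← neg_eq_zero, ← map_neg, ← h]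
  congr 1
  simp only [derivative_mul, derivative_sub, smul_eq_C_mul, C_sub, map_natCast]
  linear_combination (-U * laguerrePoly α m) * hn + (U * laguerrePoly α n) * hm

/-- The first-order relation for `L_{n+1}` brings in `2 * X` times the triple product; integration
by parts trades it for derivatives, which regroup into a Wronskian of `L_n` and `L_m`. -/
theorem tripleIntegral_succ_aux (l m n : ℕ) :
    2 * ((n : ℝ) + 1) * tripleIntegral α hα l m (n + 1) =
      (2 * n + (α + 1)) * tripleIntegral α hα l m n
      - laguerreFunctional α hα
          (X * derivative (laguerrePoly α l) * laguerrePoly α m * laguerrePoly α n)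
      + laguerreFunctional α hα (X * laguerrePoly α l *
        (derivative (laguerrePoly α n) * laguerrePoly α m -
          laguerrePoly α n * derivative (laguerrePoly α m))) := by
  have h := laguerreFunctional_parts α hα
    (laguerrePoly α l * laguerrePoly α m * laguerrePoly α n)
  have hn := succ_mul_laguerrePoly_succ α n
  unfold tripleIntegral
  rw [← sub_eq_zero]
  simp only [← smul_eq_mul, ← map_smul, ← map_sub, ← map_add]
  rw [← h]
  congr 1
  simp only [derivative_mul, smul_eq_C_mul, C_add, C_mul, C_ofNat, C_1, map_natCast,
    smul_eq_mul] at hn ⊢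
  linear_combination (2 * laguerrePoly α l * laguerrePoly α m) * hn

theorem tripleIntegral_zero_succ (m n : ℕ) :
    2 * ((n : ℝ) + 1) * tripleIntegral α hα 0 m (n + 1) =
      (n + (α + 1) + m) * tripleIntegral α hα 0 m n := by
  have h := laguerreFunctional_wronskian α hα 1 m n
  rw [tripleIntegral_succ_aux, laguerrePoly_zero]
  simp only [derivative_one, sub_zero] at h ⊢
  rw [h, tripleIntegral, laguerrePoly_zero]
  simp only [mul_zero, zero_mul, map_zero]
  ring

theorem tripleIntegral_succ_succ (l m n : ℕ) :
    2 * ((n : ℝ) + 1) * tripleIntegral α hα (l + 1) m (n + 1) =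
      (n + (α + 1) + m - (l + 1)) * tripleIntegral α hα (l + 1) m n +
      (n + (α + 1) + l - m) * tripleIntegral α hα l m n := by
  -- This `U` solves `U - U' = L_{l+1}`, because `U' = -L_l`.
  have h := laguerreFunctional_wronskian α hα (laguerrePoly α (l + 1) - laguerrePoly α l) m n
  have e : laguerrePoly α (l + 1) - laguerrePoly α l -
      derivative (laguerrePoly α (l + 1) - laguerrePoly α l) = laguerrePoly α (l + 1) := by
    rw [derivative_sub, derivative_laguerrePoly_succ]; ring
  have e2 : laguerreFunctional α hα
      (X * derivative (laguerrePoly α (l + 1)) * laguerrePoly α m * laguerrePoly α n) =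
      (l + 1) * tripleIntegral α hα (l + 1) m n - (l + 1 + α) * tripleIntegral α hα l m n := by
    unfold tripleIntegral
    rw [X_mul_derivative_laguerrePoly]
    simp only [← smul_eq_mul, ← map_smul, ← map_sub]
    congr 1
    simp only [smul_eq_C_mul, C_add, C_1, map_natCast, smul_eq_mul]
    ring
  rw [e] at h
  rw [tripleIntegral_succ_aux, h, e2]
  simp only [sub_mul, map_sub]
  simp only [tripleIntegral]
  ring

end Recurrence

/-! ### Nonnegativity of the triple integrals -/

section Positivity

variable {α : ℝ} (hα : 0 < α + 1)

theorem tripleIntegral_zero_nonneg (m n : ℕ) : 0 ≤ tripleIntegral α hα 0 m n := by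
  have step (m n : ℕ) (h : 0 ≤ tripleIntegral α hα 0 m n) :
      0 ≤ tripleIntegral α hα 0 m (n + 1) := by
    have h1 := tripleIntegral_zero_succ α hα m n
    have h2 : 0 ≤ ((n : ℝ) + (α + 1) + m) * tripleIntegral α hα 0 m n := by positivity
    rw [← h1] at h2
    exact nonneg_of_mul_nonneg_right h2 (by positivity)
  have base (n : ℕ) : 0 ≤ tripleIntegral α hα 0 0 n := by
    induction n with
    | zero =>
      simp only [tripleIntegral, laguerrePoly_zero, mul_one, laguerreFunctional_one]
      positivity
    | succ n ih => exact step 0 n ih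
  induction n with
  | zero => rw [tripleIntegral_swap_right]; exact base m
  | succ n ih => exact step m n ih

theorem tripleIntegral_one_one_one_nonneg (hβ : 0 ≤ (α + 1) ^ 2 + 3 * (α + 1) - 2) :
    0 ≤ tripleIntegral α hα 1 1 1 := by
  have h1 := tripleIntegral_succ_succ α hα 0 1 0
  have h2 := tripleIntegral_zero_succ α hα 1 0
  have h3 : tripleIntegral α hα 1 1 0 = tripleIntegral α hα 0 1 1 := by
    rw [tripleIntegral_swap_right, tripleIntegral_swap_left]
  norm_num [h3] at h1 h2 ⊢
  have h4 := mul_nonneg hβ (tripleIntegral_zero_nonneg hα 1 0)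
  linear_combination (1 / 4) * h4 - (1 / 2) * h1 - ((α + 1) / 4) * h2

/-- The largest index `n` is lowered: `l ≤ n` controls the first coefficient, and `m ≤ l` with `n ≥
2` the second. If `n = 1`, either `m = 0` or all indices are `1`. -/
theorem tripleIntegral_nonneg_of_le (hβ : 0 ≤ (α + 1) ^ 2 + 3 * (α + 1) - 2) {l m n : ℕ}
    (hml : m ≤ l) (hln : l ≤ n)
    (ih : ∀ l' m' n', l' + m' + n' < l + m + n → 0 ≤ tripleIntegral α hα l' m' n') :
    0 ≤ tripleIntegral α hα l m n := by
  rcases m with _ | m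
  · rw [tripleIntegral_swap_left]; exact tripleIntegral_zero_nonneg hα l n
  obtain ⟨l, rfl⟩ : ∃ l', l = l' + 1 := ⟨l - 1, by omega⟩
  obtain ⟨n, rfl⟩ : ∃ n', n = n' + 1 := ⟨n - 1, by omega⟩
  by_cases hn : n = 0
  · obtain ⟨rfl, rfl, rfl⟩ : n = 0 ∧ l = 0 ∧ m = 0 := by omega
    exact tripleIntegral_one_one_one_nonneg hα hβ
  have h := tripleIntegral_succ_succ α hα l (m + 1) n
  have i1 := ih (l + 1) (m + 1) n (by omega)
  have i2 := ih l (m + 1) n (by omega)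
  have c1 : 0 ≤ (n : ℝ) + (α + 1) + (m + 1 : ℕ) - (l + 1) := by
    have : (l : ℝ) ≤ n := by exact_mod_cast (by omega : l ≤ n)
    push_cast
    linarith [(Nat.cast_nonneg m : (0 : ℝ) ≤ m)]
  have c2 : 0 ≤ (n : ℝ) + (α + 1) + l - (m + 1 : ℕ) := by
    have h1 : (m : ℝ) ≤ l := by exact_mod_cast (by omega : m ≤ l)
    have h2 : (1 : ℝ) ≤ n := by exact_mod_cast (by omega : 1 ≤ n)
    push_cast
    linarith
  have h2 := add_nonneg (mul_nonneg c1 i1) (mul_nonneg c2 i2)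
  rw [← h] at h2
  exact nonneg_of_mul_nonneg_right h2 (by positivity)

theorem tripleIntegral_nonneg (hβ : 0 ≤ (α + 1) ^ 2 + 3 * (α + 1) - 2) (l m n : ℕ) :
    0 ≤ tripleIntegral α hα l m n := by
  induction hN : l + m + n using Nat.strong_induction_on generalizing l m n with
  | _ N ih =>
    have ih' : ∀ l' m' n', l' + m' + n' < l + m + n → 0 ≤ tripleIntegral α hα l' m' n' :=
      fun l' m' n' h => ih _ (hN ▸ h) l' m' n' rfl
    have sorted {l' m' n' : ℕ} (hs : l' + m' + n' = l + m + n) (h1 : m' ≤ l') (h2 : l' ≤ n') :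
        0 ≤ tripleIntegral α hα l' m' n' :=
      tripleIntegral_nonneg_of_le hα hβ h1 h2 (hs ▸ ih')
    rcases le_total m l with h1 | h1 <;> rcases le_total l n with h2 | h2 <;>
      rcases le_total m n with h3 | h3
    · exact sorted rfl h1 h2
    · exact sorted rfl h1 h2
    · rw [tripleIntegral_swap_left, tripleIntegral_swap_right, tripleIntegral_swap_left]
      exact sorted (by omega) h3 h2
    · rw [tripleIntegral_swap_left, tripleIntegral_swap_right]
      exact sorted (by omega) h3 h1
    · rw [tripleIntegral_swap_left]
      exact sorted (by omega) h1 h3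
    · rw [tripleIntegral_swap_right, tripleIntegral_swap_left]
      exact sorted (by omega) h2 h3
    · rw [tripleIntegral_swap_right]
      exact sorted (by omega) h2 h1
    · rw [tripleIntegral_swap_right]
      exact sorted (by omega) h2 h1

end Positivity

/-! ### Laguerre expansion at the origin -/

theorem superpolynomialDecay_succ {f : ℕ → ℝ}
    (hf : SuperpolynomialDecay atTop (fun n : ℕ => (n : ℝ)) f) :
    SuperpolynomialDecay atTop (fun n : ℕ => (n : ℝ)) fun n => f (n + 1) := by
  rw [superpolynomialDecay_iff_abs_tendsto_zero] at hf ⊢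
  intro i
  refine squeeze_zero (fun n => abs_nonneg _) (fun n => ?_)
    ((tendsto_add_atTop_iff_nat 1).2 (hf i))
  simp only [abs_mul, abs_pow, Nat.abs_cast]
  gcongr
  simp

theorem superpolynomialDecay_of_succ {f : ℕ → ℝ}
    (hf : SuperpolynomialDecay atTop (fun n : ℕ => (n : ℝ)) fun n => f (n + 1)) :
    SuperpolynomialDecay atTop (fun n : ℕ => (n : ℝ)) f := by
  intro i
  refine (tendsto_add_atTop_iff_nat 1).1 ?_
  have h := hf.polynomial_mul ((X + 1) ^ i) 0
  simpa using h

section Expansion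

variable (α : ℝ) (hα : 0 < α + 1)

theorem hasSum_weight_mul_pow {x : ℝ} (hx : |x| < 1) :
    HasSum (fun n => weight α n * x ^ n) (1 / (1 - x) ^ (α + 1)) := by
  have h := (Real.one_div_one_sub_rpow_hasFPowerSeriesOnBall_zero (α + 1)).hasSum
    (y := x) (by simpa [enorm_eq_nnnorm, ← NNReal.coe_lt_coe] using hx)
  simp only [FormalMultilinearSeries.ofScalars_apply_eq, zero_add, smul_eq_mul] at h
  refine h.congr_fun fun n => ?_
  rw [weight, show α + 1 + n - 1 = (n : ℝ) + α by ring]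

theorem laguerreFunctional_laguerrePoly (n : ℕ) :
    laguerreFunctional α hα (laguerrePoly α n) =
      (1 / 2) ^ (α + 1) * (weight α n * (1 / 2) ^ n) := by
  induction n with
  | zero => simp [laguerrePoly_zero, weight_zero, laguerreFunctional_one]
  | succ n ih =>
    have h := tripleIntegral_zero_succ α hα 0 n
    have hw := weight_succ α n
    simp only [tripleIntegral, laguerrePoly_zero, one_mul] at h
    have hn : (0 : ℝ) < 2 * (n + 1) := by positivity
    refine mul_left_cancel₀ hn.ne' ?_
    rw [h, ih]
    push_cast
    linear_combination (-(1 / 2) ^ (α + 1) * (1 / 2) ^ n) * hw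

theorem X_mul_laguerrePoly_succ (n : ℕ) :
    X * laguerrePoly α (n + 1) =
      (2 * (n : ℝ[X]) + 2 + C (α + 1)) * laguerrePoly α (n + 1)
      - ((n : ℝ[X]) + 2) * laguerrePoly α (n + 2) - ((n : ℝ[X]) + C (α + 1)) * laguerrePoly α n := by
  have h1 := X_mul_derivative_laguerrePoly α n
  have h2 := succ_mul_laguerrePoly_succ α (n + 1)
  simp only [C_add, map_natCast, C_1, Nat.cast_add, Nat.cast_one] at *
  linear_combination h2 + h1

/-- The decay is geometric for `q = 1`, and the three-term relation passes it from `X ^ j` to `X ^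
(j + 1)` at polynomial cost. It kills the boundary terms of the Christoffel–Darboux sum. -/
theorem superpolynomialDecay_laguerreFunctional (q : ℝ[X]) :
    SuperpolynomialDecay atTop (fun n : ℕ => (n : ℝ))
      fun n => laguerreFunctional α hα (q * laguerrePoly α n) := by
  induction q using Polynomial.induction_on' with
  | add p q hp hq => simpa only [add_mul, map_add, Pi.add_def] using hp.add hq
  | monomial j c =>
    suffices h : SuperpolynomialDecay atTop (fun n : ℕ => (n : ℝ))
        fun n => laguerreFunctional α hα (X ^ j * laguerrePoly α n) by
      refine (h.const_mul c).congr fun n => ?_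
      rw [← C_mul_X_pow_eq_monomial, mul_assoc, ← smul_eq_C_mul, map_smul, smul_eq_mul]
    induction j with
    | zero =>
      intro i
      simp only [pow_zero, one_mul, laguerreFunctional_laguerrePoly]
      -- Split `1/2 = (3/4)(2/3)`: one factor absorbs the weight, the other `n ^ i`.
      have h1 := (hasSum_weight_mul_pow α (x := 3 / 4)
        (by rw [abs_of_pos] <;> norm_num)).summable.tendsto_atTop_zero
      have h2 := tendsto_pow_const_mul_const_pow_of_lt_one i (r := 2 / 3)
        (by norm_num) (by norm_num)
      have h3 := (h1.mul h2).const_mul ((1 / 2 : ℝ) ^ (α + 1))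
      simp only [mul_zero] at h3
      refine h3.congr fun n => ?_
      have : (1 / 2 : ℝ) ^ n = (3 / 4) ^ n * (2 / 3) ^ n := by rw [← mul_pow]; norm_num
      rw [this]
      ring
    | succ j ih =>
      refine superpolynomialDecay_of_succ ?_
      have i1 := superpolynomialDecay_succ ih
      have i2 := superpolynomialDecay_succ i1
      refine (((i1.polynomial_mul (2 * X + 2 + C (α + 1))).add
        (i2.polynomial_mul (-(X + 2)))).add (ih.polynomial_mul (-(X + C (α + 1))))).congr ?_
      intro n
      simp only [Pi.add_apply, eval_neg, eval_add, eval_mul, eval_X, eval_C, eval_ofNat]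
      simp only [← smul_eq_mul, ← map_smul, ← map_add]
      congr 1
      simp only [smul_eq_C_mul, C_neg, C_add, C_mul, C_ofNat, C_1, map_natCast, smul_eq_mul]
      have hX := X_mul_laguerrePoly_succ α n
      simp only [C_add, C_1] at hX
      linear_combination (-X ^ j) * hX

/-- Christoffel–Darboux with one variable at `0`: the three-term relation telescopes. -/
theorem sum_X_mul_laguerrePoly (N : ℕ) :
    X * ∑ n ∈ Finset.range (N + 1), laguerrePoly α n =
      ((N : ℝ[X]) + 1 + C α) * laguerrePoly α N - ((N : ℝ[X]) + 1) * laguerrePoly α (N + 1) := by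
  induction N with
  | zero =>
    have h := succ_mul_laguerrePoly_succ α 0
    simp only [laguerrePoly_zero, derivative_one, C_add, C_1] at h
    simp only [zero_add, Finset.sum_range_one, laguerrePoly_zero]
    push_cast at *
    linear_combination h
  | succ N ih =>
    rw [Finset.sum_range_succ, mul_add, ih, X_mul_laguerrePoly_succ]
    simp only [C_add, C_1]
    push_cast
    ring

/-- Completeness at the origin: `∑ₙ L_n` acts as the unit mass at `0`. -/
theorem tendsto_sum_laguerreFunctional (q : ℝ[X]) :
    Tendsto (fun N => ∑ n ∈ Finset.range N, laguerreFunctional α hα (q * laguerrePoly α n))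
      atTop (𝓝 (q.eval 0)) := by
  induction q using Polynomial.induction_on' with
  | add p q hp hq =>
    simpa only [add_mul, map_add, Finset.sum_add_distrib, eval_add] using hp.add hq
  | monomial j c =>
    suffices h : Tendsto (fun N => ∑ n ∈ Finset.range N,
        laguerreFunctional α hα (X ^ j * laguerrePoly α n)) atTop (𝓝 ((X ^ j : ℝ[X]).eval 0)) by
      rw [← C_mul_X_pow_eq_monomial, eval_mul, eval_C]
      refine (h.const_mul c).congr fun N => ?_
      rw [Finset.mul_sum]
      refine Finset.sum_congr rfl fun n _ => ?_
      rw [mul_assoc, ← smul_eq_C_mul, map_smul, smul_eq_mul]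
    rcases j with _ | j
    · simp only [pow_zero, one_mul, eval_one, laguerreFunctional_laguerrePoly]
      have h := ((hasSum_weight_mul_pow α (x := 1 / 2)
        (by rw [abs_of_pos] <;> norm_num)).mul_left ((1 / 2 : ℝ) ^ (α + 1))).tendsto_sum_nat
      convert h using 2
      rw [show (1 : ℝ) - 1 / 2 = 1 / 2 by norm_num]
      have : (0 : ℝ) < (1 / 2) ^ (α + 1) := by positivity
      field_simp
    · refine (tendsto_add_atTop_iff_nat 1).1 ?_
      have h := superpolynomialDecay_laguerreFunctional α hα (X ^ j)
      have h1 := ((h.polynomial_mul (X + 1 + C α)).add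
        ((superpolynomialDecay_succ h).polynomial_mul (-(X + 1)))) 0
      simp only [pow_zero, one_mul] at h1
      simp only [eval_pow, eval_X, ne_eq, Nat.succ_ne_zero, not_false_eq_true, zero_pow]
      refine h1.congr fun N => ?_
      rw [← map_sum]
      simp only [pow_succ, mul_assoc, ← Finset.mul_sum, sum_X_mul_laguerrePoly]
      simp only [Pi.add_apply, eval_neg, eval_add, eval_X, eval_C, eval_one]
      simp only [← smul_eq_mul, ← map_smul, ← map_add]
      congr 1
      simp only [smul_eq_C_mul, C_neg, C_add, C_1, map_natCast, smul_eq_mul]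
      ring

end Expansion

/-! ### The kernel `γ`: symmetry, positivity, total mass -/

section Kernel

variable {α : ℝ}

theorem gam_eq (hα : 0 < α + 1) (n m k : ℕ) :
    gam α n m k = tripleIntegral α hα n m k / (weight α n * weight α m * weight α k) := by
  have h : tripleIntegral α hα n m k = (Real.Gamma (α + 1))⁻¹ * ∫ x in Set.Ioi (0 : ℝ),
      (laguerrePoly α n * laguerrePoly α m * laguerrePoly α k).eval x * Real.exp (-2 * x) *
        x ^ α := rfl
  rw [h, gam, mul_div_assoc, div_eq_mul_inv _ (_ * _), ← MeasureTheory.integral_mul_const]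
  refine congrArg _ (MeasureTheory.integral_congr_ae (.of_forall fun x => ?_))
  simp only [eval_mul, eval_laguerrePoly, laguerreR, div_eq_mul_inv, mul_inv]
  ring

theorem gam_swap (n m k : ℕ) : gam α n m k = gam α m n k := by
  unfold gam
  congr 2
  ext x
  ring

theorem gam_nonneg (hα : 0 < α + 1) (hβ : 0 ≤ (α + 1) ^ 2 + 3 * (α + 1) - 2) (n m k : ℕ) : 0 ≤ gam α n m k := by
  rw [gam_eq hα]
  have := tripleIntegral_nonneg hα hβ n m k
  have := weight_pos hα
  have := this n
  have := weight_pos hα m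
  have := weight_pos hα k
  positivity

theorem hasSum_weight_mul_gam (hα : 0 < α + 1) (hβ : 0 ≤ (α + 1) ^ 2 + 3 * (α + 1) - 2) (n k : ℕ) :
    HasSum (fun m => weight α m * gam α n m k) 1 := by
  have hn := (weight_pos hα n).ne'
  have hk := (weight_pos hα k).ne'
  -- Nonnegativity upgrades convergence of ordered partial sums to unconditional summation.
  rw [hasSum_iff_tendsto_nat_of_nonneg
    fun m => mul_nonneg (weight_pos hα m).le (gam_nonneg hα hβ n m k)]
  have h := (tendsto_sum_laguerreFunctional α hα (laguerrePoly α n * laguerrePoly α k)).const_mul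
    (weight α n * weight α k)⁻¹
  rw [eval_mul, eval_laguerrePoly, eval_laguerrePoly, laguerre_zero_right, laguerre_zero_right,
    inv_mul_cancel₀ (by positivity)] at h
  refine h.congr fun N => ?_
  rw [Finset.mul_sum]
  refine Finset.sum_congr rfl fun m _ => ?_
  have hm := (weight_pos hα m).ne'
  rw [gam_eq hα, tripleIntegral_swap_right, tripleIntegral]
  field_simp

end Kernel

/-! ### Jensen's inequality and reversible Markov kernels -/

/-- The tangent line of `x ↦ x ^ p` at `t` lies below the graph. -/
theorem rpow_mul_tangent_le {p : ℝ} (hp : 1 ≤ p) {t x : ℝ} (ht : 0 < t) (hx : 0 ≤ x) :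
    t ^ p * (1 + p * (x / t - 1)) ≤ x ^ p := by
  have h := one_add_mul_self_le_rpow_one_add (s := x / t - 1)
    (by linarith [div_nonneg hx ht.le]) hp
  rw [add_sub_cancel, Real.div_rpow hx ht.le, le_div_iff₀ (by positivity)] at h
  linarith

/-- Jensen: the tangent line at the mean `t` is summed against the probability `k`. The case `t = 0`
is separate, as the tangent bound divides by `t`. -/
theorem rpow_tsum_le_tsum_rpow {p : ℝ} (hp : 1 ≤ p) {f k : ℕ → ℝ} (hf : ∀ m, 0 ≤ f m)
    (hk : ∀ m, 0 ≤ k m) (hk1 : HasSum k 1) (h1 : Summable fun m => f m * k m)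
    (h2 : Summable fun m => f m ^ p * k m) :
    (∑' m, f m * k m) ^ p ≤ ∑' m, f m ^ p * k m := by
  set t := ∑' m, f m * k m with ht
  have ht0 : 0 ≤ t := tsum_nonneg fun m => mul_nonneg (hf m) (hk m)
  rcases ht0.eq_or_lt with h0 | h0
  · rw [← h0, Real.zero_rpow (by linarith)]
    exact tsum_nonneg fun m => mul_nonneg (Real.rpow_nonneg (hf m) p) (hk m)
  · have hs : HasSum (fun m => t ^ p * (1 + p * (f m / t - 1)) * k m) (t ^ p) := by
      have := ((hk1.mul_left (1 - p)).add (h1.hasSum.mul_left (p / t))).mul_left (t ^ p)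
      rw [← ht, div_mul_cancel₀ _ h0.ne'] at this
      rw [show t ^ p * ((1 - p) * 1 + p) = t ^ p by ring] at this
      exact this.congr_fun fun m => by ring
    rw [← hs.tsum_eq]
    exact hs.summable.tsum_le_tsum
      (fun m => mul_le_mul_of_nonneg_right (rpow_mul_tangent_le hp h0 (hf m)) (hk m)) h2

section Markov

variable {w : ℕ → ℝ} {K : ℕ → ℕ → ℝ}

theorem kernel_le (hw : ∀ n, 0 < w n) (hK : ∀ n m, 0 ≤ K n m) (hK1 : ∀ n, HasSum (K n) 1)
    (hsymm : ∀ n m, w n * K n m = w m * K m n) (n m : ℕ) : K n m ≤ w m / w n := by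
  rw [le_div_iff₀ (hw n), mul_comm, hsymm]
  have := le_hasSum (hK1 m) n fun i _ => hK m i
  nlinarith [hw m]

theorem summable_mul_kernel_of_summable (hw : ∀ n, 0 < w n) (hK : ∀ n m, 0 ≤ K n m)
    (hK1 : ∀ n, HasSum (K n) 1) (hsymm : ∀ n m, w n * K n m = w m * K m n) {f : ℕ → ℝ}
    (hf : ∀ m, 0 ≤ f m) (hs : Summable fun m => f m * w m) (n : ℕ) :
    Summable fun m => f m * K n m := by
  refine .of_nonneg_of_le (fun m => mul_nonneg (hf m) (hK n m)) (fun m => ?_)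
    (hs.div_const (w n))
  rw [mul_div_assoc]
  exact mul_le_mul_of_nonneg_left (kernel_le hw hK hK1 hsymm n m) (hf m)

theorem summable_abs_mul_kernel {p : ℝ} (hp : 1 ≤ p) (hw : ∀ n, 0 < w n) (hK : ∀ n m, 0 ≤ K n m)
    (hK1 : ∀ n, HasSum (K n) 1) (hsymm : ∀ n m, w n * K n m = w m * K m n) {a : ℕ → ℝ}
    (ha : Summable fun m => |a m| ^ p * w m) (n : ℕ) :
    Summable fun m => |a m| * K n m := by
  refine .of_nonneg_of_le (fun m => mul_nonneg (abs_nonneg _) (hK n m)) (fun m => ?_)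
    ((hK1 n).summable.add (summable_mul_kernel_of_summable hw hK hK1 hsymm
      (fun m => Real.rpow_nonneg (abs_nonneg (a m)) p) ha n))
  -- Compare via `|a| ≤ 1 + |a| ^ p`.
  rw [← one_add_mul]
  refine mul_le_mul_of_nonneg_right ?_ (hK n m)
  rcases le_total |a m| 1 with h | h
  · have := Real.rpow_nonneg (abs_nonneg (a m)) p
    linarith
  · have := Real.rpow_le_rpow_of_exponent_le h hp
    rw [Real.rpow_one] at this
    linarith

theorem abs_tsum_mul_kernel_le {a : ℕ → ℝ} {k : ℕ → ℝ} (hk : ∀ m, 0 ≤ k m)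
    (hs : Summable fun m => |a m| * k m) : |∑' m, a m * k m| ≤ ∑' m, |a m| * k m := by
  have e (m : ℕ) : ‖a m * k m‖ = |a m| * k m := by
    rw [Real.norm_eq_abs, abs_mul, abs_of_nonneg (hk m)]
  have h := norm_tsum_le_tsum_norm (f := fun m => a m * k m) (by simpa only [e] using hs)
  simpa only [e, Real.norm_eq_abs] using h

/-- Jensen in each row, then interchange of sums; detailed balance turns column sums into partial
row sums, at most `1`. A bound uniform in `s` gives both summability and the norm inequality. -/
theorem sum_rpow_tsum_mul_kernel_le {p : ℝ} (hp : 1 ≤ p) (hw : ∀ n, 0 < w n)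
    (hK : ∀ n m, 0 ≤ K n m) (hK1 : ∀ n, HasSum (K n) 1)
    (hsymm : ∀ n m, w n * K n m = w m * K m n) {a : ℕ → ℝ}
    (ha : Summable fun m => |a m| ^ p * w m) (s : Finset ℕ) :
    ∑ n ∈ s, |∑' m, a m * K n m| ^ p * w n ≤ ∑' m, |a m| ^ p * w m := by
  have hp0 (m : ℕ) : 0 ≤ |a m| ^ p := Real.rpow_nonneg (abs_nonneg _) p
  have h1 := summable_abs_mul_kernel hp hw hK hK1 hsymm ha
  have h2 := summable_mul_kernel_of_summable hw hK hK1 hsymm hp0 ha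
  calc ∑ n ∈ s, |∑' m, a m * K n m| ^ p * w n
      ≤ ∑ n ∈ s, ∑' m, |a m| ^ p * K n m * w n := by
        refine Finset.sum_le_sum fun n _ => ?_
        rw [tsum_mul_right]
        refine mul_le_mul_of_nonneg_right ?_ (hw n).le
        exact (Real.rpow_le_rpow (abs_nonneg _) (abs_tsum_mul_kernel_le (hK n) (h1 n))
          (by linarith)).trans
          (rpow_tsum_le_tsum_rpow hp (fun m => abs_nonneg _) (hK n) (hK1 n) (h1 n) (h2 n))
    _ = ∑' m, ∑ n ∈ s, |a m| ^ p * K n m * w n :=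
        (Summable.tsum_finsetSum fun n _ => (h2 n).mul_right (w n)).symm
    _ ≤ ∑' m, |a m| ^ p * w m := by
        refine Summable.tsum_le_tsum (fun m => ?_)
          (summable_sum fun n _ => (h2 n).mul_right (w n)) ha
        have h3 : ∑ n ∈ s, |a m| ^ p * K n m * w n = |a m| ^ p * w m * ∑ n ∈ s, K m n := by
          rw [Finset.mul_sum]
          refine Finset.sum_congr rfl fun n _ => ?_
          linear_combination |a m| ^ p * hsymm n m
        rw [h3]
        exact mul_le_of_le_one_right (mul_nonneg (hp0 m) (hw m).le)
          (sum_le_hasSum s (fun n _ => hK m n) (hK1 m))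

end Markov

end LaguerreSeq

end

/-! ### The contraction property -/

open LaguerreSeq in
theorem proposition1 (α : ℝ) (hα : (-5 + Real.sqrt 17) / 2 < α)
    (p : ℝ≥0∞) (hp : 1 ≤ p) (k : ℕ) (a : ℕ → ℝ) (ha : LaguerreSeq.MemSpace α p a) :
    (∀ n : ℕ, Summable fun m : ℕ => a m * LaguerreSeq.weight α m * LaguerreSeq.gam α n m k) ∧
      LaguerreSeq.MemSpace α p (LaguerreSeq.translation α k a) ∧
      LaguerreSeq.seqNorm α p (LaguerreSeq.translation α k a) ≤ LaguerreSeq.seqNorm α p a := by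
  have h17 : Real.sqrt 17 ^ 2 = 17 := Real.sq_sqrt (by norm_num)
  have h4 : 4 < Real.sqrt 17 := Real.lt_sqrt_of_sq_lt (by norm_num)
  have hα1 : 0 < α + 1 := by linarith
  -- The right side is `α² + 5α + 2 = (α - α₀)(α + (5 + √17)/2)`.
  have hβ : 0 ≤ (α + 1) ^ 2 + 3 * (α + 1) - 2 := by nlinarith
  have hw := weight_pos hα1
  set K : ℕ → ℕ → ℝ := fun n m => weight α m * gam α n m k with hKdef
  have hK (n m : ℕ) : 0 ≤ K n m := mul_nonneg (hw m).le (gam_nonneg hα1 hβ n m k)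
  have hK1 (n : ℕ) : HasSum (K n) 1 := hasSum_weight_mul_gam hα1 hβ n k
  have hsymm (n m : ℕ) : weight α n * K n m = weight α m * K m n := by
    simp only [hKdef, gam_swap n m]
    ring
  have hT (n : ℕ) : translation α k a n = ∑' m, a m * K n m := by
    simp only [translation, hKdef, mul_assoc]
  have of_abs (h : ∀ n, Summable fun m => |a m| * K n m) (n : ℕ) :
      Summable fun m => a m * weight α m * gam α n m k := by
    refine .of_abs ((h n).congr fun m => ?_)
    rw [mul_assoc, abs_mul, abs_of_nonneg (hK n m)]
  by_cases hpt : p = ∞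
  · simp only [MemSpace, seqNorm, hpt, if_true] at ha ⊢
    have hle (n m : ℕ) : |a m| * K n m ≤ (⨆ i, |a i|) * K n m :=
      mul_le_mul_of_nonneg_right (le_ciSup ha m) (hK n m)
    have hs (n : ℕ) : Summable fun m => |a m| * K n m :=
      .of_nonneg_of_le (fun m => mul_nonneg (abs_nonneg _) (hK n m)) (hle n)
        ((hK1 n).summable.mul_left _)
    have hb (n : ℕ) : |translation α k a n| ≤ ⨆ i, |a i| := by
      rw [hT]
      refine (abs_tsum_mul_kernel_le (hK n) (hs n)).trans ?_
      refine ((hs n).tsum_le_tsum (hle n) ((hK1 n).summable.mul_left _)).trans_eq ?_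
      rw [tsum_mul_left, (hK1 n).tsum_eq, mul_one]
    refine ⟨of_abs hs, ⟨⨆ i, |a i|, ?_⟩, ciSup_le hb⟩
    rintro _ ⟨n, rfl⟩
    exact hb n
  · simp only [MemSpace, seqNorm, hpt, if_false] at ha ⊢
    have hp1 : 1 ≤ p.toReal := by
      simpa using (ENNReal.toReal_le_toReal ENNReal.one_ne_top hpt).2 hp
    have hsum := sum_rpow_tsum_mul_kernel_le hp1 hw hK hK1 hsymm ha
    have hnn (n : ℕ) : 0 ≤ |translation α k a n| ^ p.toReal * weight α n :=
      mul_nonneg (Real.rpow_nonneg (abs_nonneg _) _) (hw n).le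
    simp only [← hT] at hsum
    refine ⟨of_abs (summable_abs_mul_kernel hp1 hw hK hK1 hsymm ha),
      summable_of_sum_le hnn hsum, ?_⟩
    exact Real.rpow_le_rpow (tsum_nonneg hnn) (Real.tsum_le_of_sum_le hnn hsum) (by positivity)
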